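/- Let $K$ be a field of characteristic different from $2$ and $3$. A $K$-algebra $L$ with bilinear multiplication $[\cdot,\cdot]$ is \emph{anticommutative} if $[x,x]=0$ for all $x\in L$; put $J(x,y,z)=[[x,y],z]+[[z,x],y]+[[y,z],x]$. An \emph{$\omega$-Lie algebra} over $K$ is an anticommutative $K$-algebra $L$ for which there is a bilinear form $\omega:L\times L\to K$ such that $$J(x,y,z)=\omega(x,y)z+\omega(z,x)y+\omega(y,z)x\qquad\text{for all }x,y,z\in L.$$ An \emph{identity} is an equation $f=0$ with $f$ a nonassociative polynomial over $K$ (an element of the free nonassociative $K$-algebra without unit on countably many variables); its degree is the largest length of a monomial occurring in $f$, an algebra satisfies it if $f$ vanishes under all substitutions of elements of the algebra for the variables, and it is \emph{nontrivial} if it is not satisfied by all anticommutative $K$-algebras. Then the minimal degree of a nontrivial identity satisfied by all $\omega$-Lie algebras over $K$ is $5$. More precisely: (1) The identity of degree $5$ $$\sum_{\sigma\in S_5}(-1)^\sigma\Big([[[[x_{\sigma(1)},x_{\sigma(2)}],x_{\sigma(3)}],x_{\sigma(4)}],x_{\sigma(5)}]+[[[x_{\sigma(1)},x_{\sigma(2)}],x_{\sigma(3)}],[x_{\sigma(4)},x_{\sigma(5)}]]\Big)=0$$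 is nontrivial and is satisfied by all $\omega$-Lie algebras over $K$. (2) No nontrivial identity of degree $\le 4$ is satisfied by all $\omega$-Lie algebras over $K$. In particular, each of the following identities fails in some $\omega$-Lie algebra over $K$: $[[[y,x],x],x]=0$; $$\alpha[[x,y],[x,z]]+\beta\big([[[x,y],x],z]-[[[x,z],x],y]\big)+\gamma\big([[[x,y],z],x]-[[[x,z],y],x]\big)+(\beta+\gamma)[[[y,z],x],x]=0,$$ for any fixed $\alpha,\beta,\gamma\in K$ not all zero; $J(x,y,[x,y])=0$; and $$[J(x,y,z),t]-[J(t,x,y),z]+[J(z,t,x),y]-[J(y,z,t),x]=0.$$ -/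

import Mathlib

universe u v

namespace OmegaLie

/-- An algebra with multiplication `x * y` (written `[x, y]` on paper) is anticommutative if
`[x, x] = 0` for all `x`; away from characteristic `2` this is the same as `[x, y] = -[y, x]`. -/
def IsAnticommutative (L : Type v) [NonUnitalNonAssocRing L] : Prop :=
  ∀ x : L, x * x = 0

/-- The Jacobian `J(x, y, z) = [[x, y], z] + [[z, x], y] + [[y, z], x]`. -/
def jacobian {L : Type v} [NonUnitalNonAssocRing L] (x y z : L) : L :=
  (x * y) * z + (z * x) * y + (y * z) * x

/-- `ω`-Lie algebras over `K`: anticommutative `K`-algebras `L` for which there is a bilinear form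
`ω` such that `J(x, y, z) = ω(x, y) z + ω(z, x) y + ω(y, z) x`. -/
structure IsOmegaLieAlgebra (K : Type u) (L : Type v) [Field K] [NonUnitalNonAssocRing L]
    [Module K L] : Prop where
  anticommutative : IsAnticommutative L
  exists_form : ∃ ω : LinearMap.BilinForm K L, ∀ x y z : L,
    jacobian x y z = ω x y • z + ω z x • y + ω y z • x

/-- Nonassociative polynomials over `K` in countably many variables. -/
abbrev Poly (K : Type u) [Field K] : Type u := FreeNonUnitalNonAssocAlgebra K ℕ

/-- The `i`-th variable. -/
noncomputable abbrev var (K : Type u) [Field K] (i : ℕ) : Poly K :=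
  FreeNonUnitalNonAssocAlgebra.of K i

section

variable {K : Type u} [Field K]

/-- The degree of a nonassociative polynomial: the largest length of a monomial that occurs in
it. -/
def degree (f : Poly K) : ℕ := f.coeff.support.sup FreeMagma.length

/-- `f = 0` is an identity of the algebra `L`: it holds under all substitutions of elements of `L`
for the variables. -/
def Satisfies (L : Type v) [NonUnitalNonAssocRing L] [Module K L] [IsScalarTower K L L]
    [SMulCommClass K L L] (f : Poly K) : Prop :=
  ∀ a : ℕ → L, FreeNonUnitalNonAssocAlgebra.lift K a f = 0

/-- `f = 0` holds in all anticommutative `K`-algebras, that is, `f` is zero in the free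
anticommutative algebra (which lives in the universe of `K`). -/
def IsTrivialIdentity (f : Poly K) : Prop :=
  ∀ (A : Type u) [NonUnitalNonAssocRing A] [Module K A] [IsScalarTower K A A]
    [SMulCommClass K A A], IsAnticommutative A → Satisfies A f

/-- `f = 0` is satisfied by all `ω`-Lie algebras over `K`. -/
def HoldsInOmegaLieAlgebras (f : Poly K) : Prop :=
  ∀ (L : Type (max u v)) [NonUnitalNonAssocRing L] [Module K L] [IsScalarTower K L L]
    [SMulCommClass K L L], IsOmegaLieAlgebra K L → Satisfies L f

end

section

variable (K : Type u) [Field K]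

/-- `∑ (-1)^σ ([[[[x_σ(1), x_σ(2)], x_σ(3)], x_σ(4)], x_σ(5)]`
`+ [[[x_σ(1), x_σ(2)], x_σ(3)], [x_σ(4), x_σ(5)]])`, summed over the permutations of five
letters. -/
noncomputable def quinticPoly : Poly K :=
  ∑ σ : Equiv.Perm (Fin 5), (Equiv.Perm.sign σ : ℤ) •
    ((((var K (σ 0) * var K (σ 1)) * var K (σ 2)) * var K (σ 3)) * var K (σ 4)
      + ((var K (σ 0) * var K (σ 1)) * var K (σ 2)) * (var K (σ 3) * var K (σ 4)))

/-- `[[[y, x], x], x]` with `x`, `y` the variables `0`, `1`. -/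
noncomputable def engelPoly : Poly K :=
  let x := var K 0
  let y := var K 1
  ((y * x) * x) * x

/-- `α[[x,y],[x,z]] + β([[[x,y],x],z] - [[[x,z],x],y]) + γ([[[x,y],z],x] - [[[x,z],y],x])`
`+ (β + γ)[[[y,z],x],x]` with `x`, `y`, `z` the variables `0`, `1`, `2`. -/
noncomputable def threeParamPoly (α β γ : K) : Poly K :=
  let x := var K 0
  let y := var K 1
  let z := var K 2
  α • ((x * y) * (x * z))
    + β • (((x * y) * x) * z - ((x * z) * x) * y)
    + γ • (((x * y) * z) * x - ((x * z) * y) * x)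
    + (β + γ) • (((y * z) * x) * x)

/-- `J(x, y, [x, y])` with `x`, `y` the variables `0`, `1`. -/
noncomputable def binaryLiePoly : Poly K :=
  let x := var K 0
  let y := var K 1
  jacobian x y (x * y)

/-- `[J(x,y,z),t] - [J(t,x,y),z] + [J(z,t,x),y] - [J(y,z,t),x]` with `x`, `y`, `z`, `t` the
variables `0`, `1`, `2`, `3`. -/
noncomputable def alternatingJacobianPoly : Poly K :=
  let x := var K 0
  let y := var K 1
  let z := var K 2
  let t := var K 3
  jacobian x y z * t - jacobian t x y * z + jacobian z t x * y - jacobian y z t * x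

end

end OmegaLie

/-!
In characteristic different from `2` and `3`, the identities of degree at most `4` of a single
four-dimensional `ω`-Lie algebra, the cyclic algebra with `e₀e₁ = e₀`, `e₁e₂ = e₁`, `e₂e₀ = e₂` and
`e₃e₀ = e₃e₁ = e₃e₂ = e₃`, already hold in every anticommutative algebra.

Modulo anticommutativity a polynomial of degree at most `4` is a combination of left-normed words
and of words `[[x, y], [z, t]]`. Polarization turns its part of highest degree into multilinear
identities of the cyclic algebra. When two of the variables of such an identity are made equal, the
values at basis vectors show that all the coefficients which anticommutativity leaves vanish. Hence
in any anticommutative algebra the identity is alternating, and so a multiple of the alternating sum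
of the left-normed word; this multiple is `0` because that sum does not vanish at `e₀, e₁, …`. Thus
the part of highest degree vanishes, and one continues with the next degree.

In an `ω`-Lie algebra, summing the quintic expression over the cyclic permutations of `x₀, x₁, x₂`
replaces `[[x₀, x₁], x₂]` by the Jacobian, that is by `ω(x₀, x₁) x₂` and its cyclic images. The two
kinds of terms become `ω(x₀, x₁) [[x₂, x₃], x₄]` and `-ω(x₀, x₁) [[x₃, x₄], x₂]`, which differ by an
even permutation of the variables and cancel in the alternating sum.
-/

namespace OmegaLie

section Anticommutative

variable {A : Type*} [NonUnitalNonAssocRing A]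

theorem IsAnticommutative.mul_eq_neg_mul (hA : IsAnticommutative A) (x y : A) :
    x * y = -(y * x) := by
  have hxy := hA (x + y)
  rw [mul_add, add_mul, add_mul, hA x, hA y, zero_add, add_zero] at hxy
  exact eq_neg_of_add_eq_zero_right hxy

end Anticommutative

section AlternatingSums

open Equiv.Perm

variable {α M : Type*} [Fintype α] [DecidableEq α] [AddCommGroup M]

/-- The alternating sum `∑ (-1)^σ g(σ)` over all permutations. -/
def altSum (g : Equiv.Perm α → M) : M := ∑ σ : Equiv.Perm α, (sign σ : ℤ) • g σ

theorem altSum_add (g h : Equiv.Perm α → M) :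
    altSum (fun σ => g σ + h σ) = altSum g + altSum h := by
  simp only [altSum, smul_add, Finset.sum_add_distrib]

theorem altSum_mul_right (g : Equiv.Perm α → M) (τ : Equiv.Perm α) :
    altSum (fun σ => g (σ * τ)) = (sign τ : ℤ) • altSum g := by
  rw [altSum, altSum, Finset.smul_sum]
  refine Fintype.sum_equiv (Equiv.mulRight τ) _ _ fun σ => ?_
  simp only [Equiv.coe_mulRight]
  rw [smul_smul, Equiv.Perm.sign_mul, Units.val_mul, mul_comm (sign σ : ℤ), ← mul_assoc,
    ← Units.val_mul, Int.units_mul_self, Units.val_one, one_mul]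

theorem altSum_sub (g h : Equiv.Perm α → M) :
    altSum (fun σ => g σ - h σ) = altSum g - altSum h := by
  simp only [altSum, smul_sub, Finset.sum_sub_distrib]

theorem altSum_smul {α R M : Type*} [Fintype α] [DecidableEq α] [Ring R] [AddCommGroup M]
    [Module R M] (r : R) (g : Equiv.Perm α → M) : altSum (fun σ => r • g σ) = r • altSum g := by
  simp only [altSum, Finset.smul_sum, smul_comm r]

theorem altSum_cyclic (g : Equiv.Perm α → M) {κ : Equiv.Perm α} (hκ : Equiv.Perm.sign κ = 1) :
    altSum (fun σ => g σ + g (σ * κ) + g (σ * κ * κ)) = 3 • altSum g := by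
  have hrot : altSum (fun σ => g (σ * κ)) = altSum g := by simp [altSum_mul_right, hκ]
  have hrot₂ : altSum (fun σ => g (σ * κ * κ)) = altSum g := by
    simp [altSum_mul_right (fun σ => g (σ * κ)), hκ, hrot]
  rw [altSum_add (fun σ => g σ + g (σ * κ)), altSum_add, hrot, hrot₂, succ_nsmul, two_nsmul]

end AlternatingSums

section SumsOverPermutations

variable {M : Type*} [AddCommGroup M]

theorem sum_perm_fin_two (F : (Fin 2 → Fin 2) → ℤ → M) :
    ∑ σ : Equiv.Perm (Fin 2), F σ (Equiv.Perm.sign σ) = F ![0, 1] 1 + F ![1, 0] (-1) := by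
  have huniv : ((Finset.univ : Finset (Equiv.Perm (Fin 2))).val.map fun σ : Equiv.Perm _ =>
      ((⇑σ : Fin 2 → Fin 2), (Equiv.Perm.sign σ : ℤ))) = {(![0, 1], 1), (![1, 0], -1)} := by
    decide
  simpa using congrArg (fun s => (s.map fun x => F x.1 x.2).sum) huniv

theorem sum_perm_fin_three (F : (Fin 3 → Fin 3) → ℤ → M) :
    ∑ σ : Equiv.Perm (Fin 3), F σ (Equiv.Perm.sign σ) =
      F ![0, 1, 2] 1 + F ![0, 2, 1] (-1) + F ![1, 0, 2] (-1) + F ![1, 2, 0] 1 +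
        F ![2, 0, 1] 1 + F ![2, 1, 0] (-1) := by
  have huniv : ((Finset.univ : Finset (Equiv.Perm (Fin 3))).val.map fun σ : Equiv.Perm _ =>
      ((⇑σ : Fin 3 → Fin 3), (Equiv.Perm.sign σ : ℤ))) =
      {(![0, 1, 2], 1), (![0, 2, 1], -1), (![1, 0, 2], -1), (![1, 2, 0], 1), (![2, 0, 1], 1),
        (![2, 1, 0], -1)} := by
    decide
  simpa [add_assoc] using congrArg (fun s => (s.map fun x => F x.1 x.2).sum) huniv

theorem sum_perm_fin_four (F : (Fin 4 → Fin 4) → ℤ → M) :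
    ∑ σ : Equiv.Perm (Fin 4), F σ (Equiv.Perm.sign σ) =
      F ![0, 1, 2, 3] 1 + F ![0, 1, 3, 2] (-1) + F ![0, 2, 1, 3] (-1) + F ![0, 2, 3, 1] 1 +
      F ![0, 3, 1, 2] 1 + F ![0, 3, 2, 1] (-1) + F ![1, 0, 2, 3] (-1) + F ![1, 0, 3, 2] 1 +
      F ![1, 2, 0, 3] 1 + F ![1, 2, 3, 0] (-1) + F ![1, 3, 0, 2] (-1) + F ![1, 3, 2, 0] 1 +
      F ![2, 0, 1, 3] 1 + F ![2, 0, 3, 1] (-1) + F ![2, 1, 0, 3] (-1) + F ![2, 1, 3, 0] 1 +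
      F ![2, 3, 0, 1] 1 + F ![2, 3, 1, 0] (-1) + F ![3, 0, 1, 2] (-1) + F ![3, 0, 2, 1] 1 +
      F ![3, 1, 0, 2] 1 + F ![3, 1, 2, 0] (-1) + F ![3, 2, 0, 1] (-1) + F ![3, 2, 1, 0] 1 := by
  have huniv : ((Finset.univ : Finset (Equiv.Perm (Fin 4))).val.map fun σ : Equiv.Perm _ =>
      ((⇑σ : Fin 4 → Fin 4), (Equiv.Perm.sign σ : ℤ))) =
      {(![0, 1, 2, 3], 1), (![0, 1, 3, 2], -1), (![0, 2, 1, 3], -1), (![0, 2, 3, 1], 1),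
        (![0, 3, 1, 2], 1), (![0, 3, 2, 1], -1), (![1, 0, 2, 3], -1), (![1, 0, 3, 2], 1),
        (![1, 2, 0, 3], 1), (![1, 2, 3, 0], -1), (![1, 3, 0, 2], -1), (![1, 3, 2, 0], 1),
        (![2, 0, 1, 3], 1), (![2, 0, 3, 1], -1), (![2, 1, 0, 3], -1), (![2, 1, 3, 0], 1),
        (![2, 3, 0, 1], 1), (![2, 3, 1, 0], -1), (![3, 0, 1, 2], -1), (![3, 0, 2, 1], 1),
        (![3, 1, 0, 2], 1), (![3, 1, 2, 0], -1), (![3, 2, 0, 1], -1), (![3, 2, 1, 0], 1)} := by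
    decide +kernel
  simpa [add_assoc] using congrArg (fun s => (s.map fun x => F x.1 x.2).sum) huniv

end SumsOverPermutations

section Polarization

open Finset

variable {E W : Type*} [AddCommGroup E] [AddCommGroup W]

/-- The cross effect (polarization) of a map `F` between additive groups: the alternating sum of
the values of `F` on the partial sums of the family `z`. It annihilates homogeneous polynomial
maps whose degree is less than the number of the `z j` and turns the diagonal of a multilinear
form of that many arguments into its symmetrization. -/
def crossEffect {κ : Type*} [Fintype κ] [DecidableEq κ] (F : E → W) (z : κ → E) : W :=
  ∑ t : Finset κ, (-1 : ℤ) ^ #t • F (∑ j ∈ tᶜ, z j)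

/-- Polynomial maps of degree less than `n`, expressed by the vanishing of the cross effects on
`n` vectors; for `n = 0` this only says that `F 0 = 0`. -/
def HasDegreeLT (n : ℕ) (F : E → W) : Prop :=
  ∀ z : Fin n → E, crossEffect F z = 0

theorem crossEffect_add {κ : Type*} [Fintype κ] [DecidableEq κ] (F G : E → W) (z : κ → E) :
    crossEffect (F + G) z = crossEffect F z + crossEffect G z := by
  simp only [crossEffect, Pi.add_apply, smul_add, sum_add_distrib]

theorem HasDegreeLT.add {n : ℕ} {F G : E → W} (hF : HasDegreeLT n F) (hG : HasDegreeLT n G) :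
    HasDegreeLT n (F + G) := fun z => by
  rw [crossEffect_add, hF, hG, add_zero]

theorem hasDegreeLT_zero (n : ℕ) : HasDegreeLT n (0 : E → W) := fun z => by
  simp [crossEffect]

variable {R : Type*} [CommSemiring R] [Module R E] [Module R W]

theorem crossEffect_diag {ι κ : Type*} [Fintype ι] [DecidableEq ι] [Fintype κ] [DecidableEq κ]
    (Ψ : MultilinearMap R (fun _ : ι => E) W) (z : κ → E) :
    crossEffect (fun x => Ψ fun _ => x) z =
      ∑ r : ι → κ with Function.Surjective r, Ψ (z ∘ r) := by
  let missing (j : κ) : Finset (ι → κ) := {r | ∀ i, r i ≠ j}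
  have hsurj : ({r | Function.Surjective r} : Finset (ι → κ)) =
      univ.inf fun j => (missing j)ᶜ := by
    ext r
    rw [mem_filter_univ]
    simp [missing, Finset.mem_inf, Function.Surjective]
  have hmissing (t : Finset κ) : Fintype.piFinset (fun _ : ι => tᶜ) = t.inf missing := by
    ext r
    simp only [Fintype.mem_piFinset, mem_compl, Finset.mem_inf, missing, mem_filter_univ]
    exact ⟨fun h j hj i hij => h i (hij ▸ hj), fun h i hi => h _ hi i rfl⟩
  rw [hsurj, inclusion_exclusion_sum_inf_compl, powerset_univ, crossEffect]
  refine sum_congr rfl fun t _ => ?_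
  rw [Ψ.map_sum_finset, hmissing]
  rfl

theorem hasDegreeLT_diag {m n : ℕ} (hmn : m < n) (Ψ : MultilinearMap R (fun _ : Fin m => E) W) :
    HasDegreeLT n fun x => Ψ fun _ => x := fun z => by
  rw [crossEffect_diag]
  refine sum_eq_zero fun r hr => absurd (Fintype.card_le_of_surjective r (mem_filter.1 hr).2) ?_
  simpa using hmn

theorem crossEffect_diag_self {ι : Type*} [Fintype ι] [DecidableEq ι]
    (Ψ : MultilinearMap R (fun _ : ι => E) W) (z : ι → E) :
    crossEffect (fun x => Ψ fun _ => x) z = ∑ σ : Equiv.Perm ι, Ψ (z ∘ σ) := by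
  rw [crossEffect_diag]
  refine (sum_bij' (fun (σ : Equiv.Perm ι) _ => ⇑σ)
    (fun r hr => Equiv.ofBijective r (Finite.surjective_iff_bijective.1 (mem_filter.1 hr).2))
    ?_ ?_ ?_ ?_ ?_).symm
  · exact fun σ _ => mem_filter.2 ⟨mem_univ _, σ.surjective⟩
  · exact fun _ _ => mem_univ _
  · exact fun σ _ => Equiv.ext fun _ => rfl
  · exact fun _ _ => rfl
  · exact fun _ _ => rfl

end Polarization

section MultilinearPolynomials

open Finset Nat

variable {K P V W ι : Type*} [Field K] [AddCommGroup P] [Module K P] [AddCommGroup V] [Module K V]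
  [AddCommGroup W] [Module K W] [Fintype ι] [DecidableEq ι]

/-- The multilinear polynomial `∑ σ, T (p σ) (y ∘ σ)` in the variables `y i`, where `P` is a space
of coefficients and `T q` evaluates words with coefficient `q`. The coefficients are indexed by
all words `ι → ι`, but only those at permutations matter. -/
def multilinearPoly (T : P →ₗ[K] MultilinearMap K (fun _ : ι => V) W) (p : (ι → ι) → P) :
    MultilinearMap K (fun _ : ι => V) W :=
  ∑ σ : Equiv.Perm ι, (T (p σ)).domDomCongr σ

theorem multilinearPoly_apply (T : P →ₗ[K] MultilinearMap K (fun _ : ι => V) W)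
    (p : (ι → ι) → P) (y : ι → V) :
    multilinearPoly T p y = ∑ σ : Equiv.Perm ι, T (p σ) (y ∘ σ) := by
  rw [multilinearPoly, _root_.sum_apply]
  rfl

theorem multilinearPoly_comp_perm (T : P →ₗ[K] MultilinearMap K (fun _ : ι => V) W)
    (p : (ι → ι) → P) (y : ι → V) (τ : Equiv.Perm ι) :
    multilinearPoly T p (y ∘ τ) = multilinearPoly T (fun r => p (τ.symm ∘ r)) y := by
  simp only [multilinearPoly_apply]
  refine Fintype.sum_equiv (Equiv.mulLeft τ) _ _ fun σ => ?_
  have hσ : τ.symm ∘ ⇑(τ * σ) = σ := funext fun i => τ.symm_apply_apply (σ i)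
  rw [Equiv.coe_mulLeft, hσ]
  rfl

theorem multilinearPoly_comp_perm_of_alternating {T : P →ₗ[K] MultilinearMap K (fun _ : ι => V) W}
    {p : (ι → ι) → P}
    (h : ∀ (y : ι → V) (i j : ι), y i = y j → i ≠ j → multilinearPoly T p y = 0)
    (y : ι → V) (τ : Equiv.Perm ι) :
    multilinearPoly T p (y ∘ τ) = (Equiv.Perm.sign τ : ℤ) • multilinearPoly T p y :=
  AlternatingMap.map_perm ⟨multilinearPoly T p, h⟩ y τ

theorem factorial_smul_multilinearPoly {T : P →ₗ[K] MultilinearMap K (fun _ : ι => V) W}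
    {p : (ι → ι) → P}
    (h : ∀ (y : ι → V) (i j : ι), y i = y j → i ≠ j → multilinearPoly T p y = 0) (y : ι → V) :
    (Fintype.card ι)! • multilinearPoly T p y =
      altSum fun ρ : Equiv.Perm ι => T (altSum fun σ : Equiv.Perm ι => p σ) (y ∘ ρ) := by
  have hsigned (τ : Equiv.Perm ι) :
      multilinearPoly T p y = (Equiv.Perm.sign τ : ℤ) • multilinearPoly T p (y ∘ τ) := by
    rw [multilinearPoly_comp_perm_of_alternating h, smul_smul, ← Units.val_mul, Int.units_mul_self,
      Units.val_one, one_smul]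
  calc (Fintype.card ι)! • multilinearPoly T p y
      = ∑ _ : Equiv.Perm ι, multilinearPoly T p y := by
        rw [sum_const, Finset.card_univ, Fintype.card_perm]
    _ = altSum fun τ => ∑ σ : Equiv.Perm ι, T (p σ) (y ∘ (τ * σ : Equiv.Perm ι)) :=
        sum_congr rfl fun τ _ => by rw [hsigned τ, multilinearPoly_apply]; rfl
    _ = ∑ σ : Equiv.Perm ι, altSum fun τ => T (p σ) (y ∘ (τ * σ : Equiv.Perm ι)) := by
        simp only [altSum, smul_sum]
        exact sum_comm
    _ = ∑ σ : Equiv.Perm ι, (Equiv.Perm.sign σ : ℤ) • altSum fun ρ => T (p σ) (y ∘ ρ) :=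
        sum_congr rfl fun σ _ => altSum_mul_right (fun ρ => T (p σ) (y ∘ ρ)) σ
    _ = altSum fun ρ => T (altSum fun σ => p σ) (y ∘ ρ) := by
        simp only [altSum, map_sum, map_zsmul, _root_.sum_apply, _root_.smul_apply, smul_sum]
        rw [sum_comm]
        exact sum_congr rfl fun _ _ => sum_congr rfl fun _ _ => smul_comm _ _ _

end MultilinearPolynomials

section Substitution

open Finset Nat

variable {K P V W V' W' X : Type*} [Field K] [AddCommGroup P] [Module K P]
  [AddCommGroup V] [Module K V] [AddCommGroup W] [Module K W]
  [AddCommGroup V'] [Module K V'] [AddCommGroup W'] [Module K W']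

section

variable {ι : Type*}

/-- The multilinear form `∑ v, T (c v) (z i (v i))ᵢ` on families `X → V`. Its diagonal at `a` is
the value at `a` of the homogeneous polynomial whose word `v : ι → X` has the coefficient `c v`;
here `P` is a space of coefficients and `T p` evaluates the words with coefficient `p`. -/
noncomputable def substForm (T : P →ₗ[K] MultilinearMap K (fun _ : ι => V) W) :
    ((ι → X) →₀ P) →ₗ[K] MultilinearMap K (fun _ : ι => X → V) W :=
  Finsupp.lsum K fun v =>
    (MultilinearMap.compLinearMapₗ fun i => LinearMap.proj (v i)) ∘ₗ T

theorem substForm_apply (T : P →ₗ[K] MultilinearMap K (fun _ : ι => V) W) (c : (ι → X) →₀ P)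
    (z : ι → X → V) : substForm T c z = c.sum fun v p => T p fun i => z i (v i) := by
  simp only [substForm, Finsupp.lsum_apply, Finsupp.sum, _root_.sum_apply]
  rfl

theorem substForm_single (T : P →ₗ[K] MultilinearMap K (fun _ : ι => V) W) (v : ι → X) (p : P)
    (a : X → V) : substForm T (Finsupp.single v p) (fun _ => a) = T p (a ∘ v) := by
  rw [substForm_apply, Finsupp.sum_single_index (by simp)]
  rfl

theorem substForm_pi_single [DecidableEq X]
    (T : P →ₗ[K] MultilinearMap K (fun _ : ι => V) W) (c : (ι → X) →₀ P) (w : ι → X)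
    (y : ι → V) : substForm T c (fun i => Pi.single (w i) (y i)) = T (c w) y := by
  rw [substForm_apply, Finsupp.sum, Finset.sum_eq_single w]
  · simp
  · intro v _ hv
    obtain ⟨i, hi⟩ := Function.ne_iff.1 hv
    exact (T (c v)).map_coord_zero i (Pi.single_eq_of_ne hi _)
  · intro hw
    simp [Finsupp.notMem_support_iff.1 hw]

theorem multilinearPoly_eq_zero_of_substForm_add_eq_zero {n : ℕ}
    {T : P →ₗ[K] MultilinearMap K (fun _ : Fin n => V) W} {c : (Fin n → X) →₀ P}
    {F : (X → V) → W} (hF : HasDegreeLT n F)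
    (h : ∀ a : X → V, substForm T c (fun _ => a) + F a = 0) (w : Fin n → X) :
    multilinearPoly T (fun r => c (w ∘ r)) = 0 := by
  classical
  ext y
  have hcross : crossEffect ((fun a => substForm T c fun _ => a) + F)
      (fun i => Pi.single (w i) (y i)) = 0 := by
    rw [show (fun a => substForm T c fun _ => a) + F = 0 from funext h, hasDegreeLT_zero]
  rw [crossEffect_add, hF, add_zero, crossEffect_diag_self] at hcross
  rw [multilinearPoly_apply, _root_.zero_apply, ← hcross]
  exact sum_congr rfl fun σ _ => (substForm_pi_single T c (w ∘ σ) (y ∘ σ)).symm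

theorem substForm_diag_eq_zero [Fintype ι] [DecidableEq ι]
    (hfact : ((Fintype.card ι)! : K) ≠ 0)
    {T : P →ₗ[K] MultilinearMap K (fun _ : ι => V) W} {c : (ι → X) →₀ P} {a : X → V}
    (h : ∀ w : ι → X, multilinearPoly T (fun r => c (w ∘ r)) (a ∘ w) = 0) :
    substForm T c (fun _ => a) = 0 := by
  classical
  let letters : Finset X := c.support.biUnion fun v => univ.image v
  let words : Finset (ι → X) := Fintype.piFinset fun _ => letters
  have hsupp : c.support ⊆ words := fun v hv => Fintype.mem_piFinset.2 fun i =>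
    mem_biUnion.2 ⟨v, hv, mem_image_of_mem v (mem_univ i)⟩
  have hsum : substForm T c (fun _ => a) = ∑ v ∈ words, T (c v) (a ∘ v) := by
    rw [substForm_apply]
    exact Finsupp.sum_of_support_subset c hsupp _ (by simp)
  have hperm (σ : Equiv.Perm ι) :
      ∑ v ∈ words, T (c v) (a ∘ v) = ∑ v ∈ words, T (c (v ∘ σ)) (a ∘ v ∘ σ) := by
    refine (sum_equiv (σ.symm.arrowCongr (.refl X)) (fun v => ?_) fun _ _ => rfl).symm
    simp only [words, Fintype.mem_piFinset]
    exact σ.surjective.forall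
  have htotal : ((Fintype.card ι)! : K) • ∑ v ∈ words, T (c v) (a ∘ v) = 0 := by
    calc ((Fintype.card ι)! : K) • ∑ v ∈ words, T (c v) (a ∘ v)
        = ∑ _ : Equiv.Perm ι, ∑ v ∈ words, T (c v) (a ∘ v) := by
          rw [sum_const, Finset.card_univ, Fintype.card_perm, Nat.cast_smul_eq_nsmul]
      _ = ∑ v ∈ words, ∑ σ : Equiv.Perm ι, T (c (v ∘ σ)) (a ∘ v ∘ σ) := by
          rw [sum_congr rfl fun σ _ => hperm σ, sum_comm]
      _ = 0 := sum_eq_zero fun v _ => (multilinearPoly_apply _ _ _).symm.trans (h v)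
  rw [hsum]
  exact (smul_eq_zero.1 htotal).resolve_left hfact

end

variable {n : ℕ}

/-- Every multilinear identity of `T` is one of `T'`, where `T` and `T'` evaluate the same words
in two algebras. -/
def InheritsMultilinearIdentities (T : P →ₗ[K] MultilinearMap K (fun _ : Fin n => V) W)
    (T' : P →ₗ[K] MultilinearMap K (fun _ : Fin n => V') W') : Prop :=
  ∀ p : (Fin n → Fin n) → P, multilinearPoly T p = 0 → multilinearPoly T' p = 0

theorem InheritsMultilinearIdentities.eq_zero_of_add_eq_zero
    {T : P →ₗ[K] MultilinearMap K (fun _ : Fin n => V) W}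
    {T' : P →ₗ[K] MultilinearMap K (fun _ : Fin n => V') W'}
    (hT : InheritsMultilinearIdentities T T') (hfact : (n ! : K) ≠ 0) {c : (Fin n → X) →₀ P}
    {F : (X → V) → W} (hF : HasDegreeLT n F)
    (h : ∀ a : X → V, substForm T c (fun _ => a) + F a = 0) :
    (∀ a : X → V', substForm T' c (fun _ => a) = 0) ∧ ∀ a : X → V, F a = 0 := by
  have hfact' : ((Fintype.card (Fin n))! : K) ≠ 0 := by rwa [Fintype.card_fin]
  have hmulti (w : Fin n → X) := multilinearPoly_eq_zero_of_substForm_add_eq_zero hF h w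
  have htop (a : X → V) : substForm T c (fun _ => a) = 0 :=
    substForm_diag_eq_zero hfact' fun w => by rw [hmulti w, _root_.zero_apply]
  refine ⟨fun a => substForm_diag_eq_zero hfact' fun w => ?_, fun a => ?_⟩
  · rw [hT _ (hmulti w), _root_.zero_apply]
  · rw [← h a, htop a, zero_add]

/-- The pair `0, 1` stands for all pairs of variables since renaming the variables turns an
identity of `T` into another one. -/
theorem inheritsMultilinearIdentities_of_collapse (hfact : ((n + 2)! : K) ≠ 0)
    {T : P →ₗ[K] MultilinearMap K (fun _ : Fin (n + 2) => V) W}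
    {T' : P →ₗ[K] MultilinearMap K (fun _ : Fin (n + 2) => V') W'}
    (hcollapse : ∀ p, multilinearPoly T p = 0 → ∀ y : Fin (n + 2) → V', y 0 = y 1 →
      multilinearPoly T' p y = 0)
    (halt : ∀ q : P,
      (∀ y : Fin (n + 2) → V, altSum (fun ρ : Equiv.Perm (Fin (n + 2)) => T q (y ∘ ρ)) = 0) →
      ∀ y : Fin (n + 2) → V', altSum (fun ρ : Equiv.Perm (Fin (n + 2)) => T' q (y ∘ ρ)) = 0) :
    InheritsMultilinearIdentities T T' := by
  intro p hp
  have hrename (τ : Equiv.Perm (Fin (n + 2))) : multilinearPoly T (fun r => p (τ ∘ r)) = 0 := by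
    ext y
    rw [← τ.symm_symm, ← multilinearPoly_comp_perm, hp]
    rfl
  have hcollapse' (y : Fin (n + 2) → V') (i j : Fin (n + 2)) (hy : y i = y j) (hij : i ≠ j) :
      multilinearPoly T' p y = 0 := by
    obtain ⟨τ, hτ⟩ := Equiv.Perm.exists_extending_pair ![(0 : Fin (n + 2)), 1] ![i, j]
      (by simp [Function.Injective, Fin.forall_fin_two])
      (by simp [Function.Injective, Fin.forall_fin_two, hij, hij.symm])
    obtain ⟨rfl, rfl⟩ : τ 0 = i ∧ τ 1 = j := ⟨hτ 0, hτ 1⟩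
    simpa [multilinearPoly_comp_perm, ← Function.comp_assoc] using
      hcollapse _ (hrename τ) (y ∘ τ) hy
  ext y
  have hT := factorial_smul_multilinearPoly (T := T) (p := p) (by simp [hp])
  have hT' := factorial_smul_multilinearPoly hcollapse' y
  rw [halt _ fun z => by rw [← hT, hp]; simp] at hT'
  rw [← Nat.cast_smul_eq_nsmul K, Fintype.card_fin] at hT'
  exact (smul_eq_zero.1 hT').resolve_left hfact

end Substitution

section Words

variable (K A : Type*) [Field K] [NonUnitalNonAssocRing A] [Module K A] [IsScalarTower K A A]
  [SMulCommClass K A A]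

/-- The left-normed word `[[[x₀, x₁], x₂], …, xₙ]` of length `n + 1`. -/
def leftNormed : ∀ n : ℕ, MultilinearMap K (fun _ : Fin (n + 1) => A) A
  | 0 => MultilinearMap.ofSubsingleton K A A (0 : Fin 1) LinearMap.id
  | n + 1 => ((LinearMap.mul K A).compMultilinearMap (leftNormed n)).uncurryRight

/-- The word `[[x₀, x₁], [x₂, x₃]]`. -/
def balanced : MultilinearMap K (fun _ : Fin 4 => A) A :=
  MultilinearMap.mk' (fun x => x 0 * x 1 * (x 2 * x 3))
    (fun x i a b => by fin_cases i <;> simp [mul_add, add_mul])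
    (fun x i r a => by fin_cases i <;> simp [smul_mul_assoc, mul_smul_comm])

/-- The multiples of the left-normed word of length `n + 1`. -/
def leftNormedTerm (n : ℕ) : K →ₗ[K] MultilinearMap K (fun _ : Fin (n + 1) => A) A :=
  LinearMap.toSpanSingleton K _ (leftNormed K A n)

/-- The linear combinations of the two words `[[[x₀, x₁], x₂], x₃]` and `[[x₀, x₁], [x₂, x₃]]`. -/
def quarticTerm : K × K →ₗ[K] MultilinearMap K (fun _ : Fin 4 => A) A :=
  (leftNormedTerm K A 3).coprod (LinearMap.toSpanSingleton K _ (balanced K A))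

variable {K A}

theorem leftNormed_zero_apply (x : Fin 1 → A) : leftNormed K A 0 x = x 0 := rfl

theorem leftNormed_one_apply (x : Fin 2 → A) : leftNormed K A 1 x = x 0 * x 1 := rfl

theorem leftNormed_two_apply (x : Fin 3 → A) : leftNormed K A 2 x = x 0 * x 1 * x 2 := rfl

theorem leftNormed_three_apply (x : Fin 4 → A) :
    leftNormed K A 3 x = x 0 * x 1 * x 2 * x 3 := rfl

theorem leftNormed_succ_apply {n : ℕ} (x : Fin (n + 2) → A) :
    leftNormed K A (n + 1) x = leftNormed K A n (Fin.init x) * x (Fin.last (n + 1)) := rfl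

@[simp]
theorem leftNormedTerm_apply {n : ℕ} (r : K) (x : Fin (n + 1) → A) :
    leftNormedTerm K A n r x = r • leftNormed K A n x := rfl

@[simp]
theorem quarticTerm_apply (p : K × K) (x : Fin 4 → A) :
    quarticTerm K A p x = p.1 • (x 0 * x 1 * x 2 * x 3) + p.2 • (x 0 * x 1 * (x 2 * x 3)) := rfl

end Words

section MonomialsModuloAnticommutativity

variable (K : Type u) [Field K] {X : Type*}

/-- Modulo anticommutativity, the nonassociative monomial `m` is a multiple (by a sign) of a
left-normed word of length `n + 1`. -/
def IsLeftNormed (n : ℕ) (m : FreeMagma X) : Prop :=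
  ∃ (ε : K) (v : Fin (n + 1) → X), ∀ (A : Type u) [NonUnitalNonAssocRing A] [Module K A]
    [IsScalarTower K A A] [SMulCommClass K A A], IsAnticommutative A → ∀ a : X → A,
      FreeMagma.lift a m = ε • leftNormed K A n (a ∘ v)

variable {K}

theorem isLeftNormed_of (i : X) : IsLeftNormed K 0 (.of i) :=
  ⟨1, fun _ => i, fun A _ _ _ _ _ a => by simp [leftNormed_zero_apply]⟩

theorem IsLeftNormed.mul_of {n : ℕ} {m : FreeMagma X} (hm : IsLeftNormed K n m) (i : X) :
    IsLeftNormed K (n + 1) (m * .of i) := by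
  obtain ⟨ε, v, h⟩ := hm
  refine ⟨ε, Fin.snoc v i, fun A _ _ _ _ hA a => ?_⟩
  rw [map_mul, h A hA, FreeMagma.lift_of, smul_mul_assoc, Fin.comp_snoc, leftNormed_succ_apply,
    Fin.init_snoc, Fin.snoc_last]

theorem IsLeftNormed.mul_swap {n : ℕ} {m m' : FreeMagma X} (h : IsLeftNormed K n (m * m')) :
    IsLeftNormed K n (m' * m) := by
  obtain ⟨ε, v, h⟩ := h
  refine ⟨-ε, v, fun A _ _ _ _ hA a => ?_⟩
  rw [map_mul, hA.mul_eq_neg_mul, ← map_mul, h A hA, neg_smul]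

theorem exists_eq_of_length_eq_one : ∀ m : FreeMagma X, m.length = 1 → ∃ i, m = .of i
  | .of i, _ => ⟨i, rfl⟩
  | .mul x y, h => by
    have hlen : x.length + y.length = 1 := h
    have := x.length_pos
    have := y.length_pos
    omega

theorem isLeftNormed_of_length_le_three {n : ℕ} :
    ∀ m : FreeMagma X, m.length = n + 1 → n ≤ 2 → IsLeftNormed K n m
  | .of i, hlen, _ => by
    obtain rfl : n = 0 := by simpa [FreeMagma.length] using hlen.symm
    exact isLeftNormed_of i
  | .mul x y, hlen, hn => by
    replace hlen : x.length + y.length = n + 1 := hlen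
    have hx := x.length_pos
    have hy := y.length_pos
    obtain ⟨k, rfl⟩ : ∃ k, n = k + 1 := ⟨n - 1, by omega⟩
    obtain hy1 | hx1 : y.length = 1 ∨ x.length = 1 := by omega
    · obtain ⟨i, rfl⟩ := exists_eq_of_length_eq_one y hy1
      exact (isLeftNormed_of_length_le_three x (by omega) (by omega)).mul_of i
    · obtain ⟨i, rfl⟩ := exists_eq_of_length_eq_one x hx1
      exact ((isLeftNormed_of_length_le_three y (by omega) (by omega)).mul_of i).mul_swap

theorem isLeftNormed_or_eq_mul_of_length_eq_four (m : FreeMagma X) (hm : m.length = 4) :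
    IsLeftNormed K 3 m ∨ ∃ x y, m = x * y ∧ IsLeftNormed K 1 x ∧ IsLeftNormed K 1 y := by
  obtain _ | ⟨x, y⟩ := m
  · simp [FreeMagma.length] at hm
  replace hm : x.length + y.length = 4 := hm
  have hx := x.length_pos
  have hy := y.length_pos
  obtain hy1 | hx1 | hx2 : y.length = 1 ∨ x.length = 1 ∨ x.length = 2 := by omega
  · obtain ⟨i, rfl⟩ := exists_eq_of_length_eq_one y hy1
    exact .inl ((isLeftNormed_of_length_le_three x (by omega) le_rfl).mul_of i)
  · obtain ⟨i, rfl⟩ := exists_eq_of_length_eq_one x hx1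
    exact .inl ((isLeftNormed_of_length_le_three y (by omega) le_rfl).mul_of i).mul_swap
  · exact .inr ⟨x, y, rfl, isLeftNormed_of_length_le_three x hx2 one_le_two,
      isLeftNormed_of_length_le_three y (by omega) one_le_two⟩

end MonomialsModuloAnticommutativity

section NormalForm

variable {K : Type u} [Field K]

/-- Modulo anticommutativity, `f` is a linear combination of the words `x`, `[x, y]`,
`[[x, y], z]`, `[[[x, y], z], t]` and `[[x, y], [z, t]]`. -/
def HasNormalForm (f : Poly K) : Prop :=
  ∃ (c₄ : (Fin 4 → ℕ) →₀ K × K) (c₃ : (Fin 3 → ℕ) →₀ K) (c₂ : (Fin 2 → ℕ) →₀ K)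
    (c₁ : (Fin 1 → ℕ) →₀ K), ∀ (A : Type u) [NonUnitalNonAssocRing A] [Module K A]
      [IsScalarTower K A A] [SMulCommClass K A A], IsAnticommutative A → ∀ a : ℕ → A,
        FreeNonUnitalNonAssocAlgebra.lift K a f =
          substForm (quarticTerm K A) c₄ (fun _ => a) +
            (substForm (leftNormedTerm K A 2) c₃ (fun _ => a) +
              (substForm (leftNormedTerm K A 1) c₂ (fun _ => a) +
                substForm (leftNormedTerm K A 0) c₁ (fun _ => a)))

theorem HasNormalForm.zero : HasNormalForm (0 : Poly K) :=
  ⟨0, 0, 0, 0, fun A _ _ _ _ _ a => by simp⟩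

theorem HasNormalForm.add {f g : Poly K} (hf : HasNormalForm f) (hg : HasNormalForm g) :
    HasNormalForm (f + g) := by
  obtain ⟨c₄, c₃, c₂, c₁, hf⟩ := hf
  obtain ⟨d₄, d₃, d₂, d₁, hg⟩ := hg
  refine ⟨c₄ + d₄, c₃ + d₃, c₂ + d₂, c₁ + d₁, fun A _ _ _ _ hA a => ?_⟩
  simp only [map_add, hf A hA, hg A hA, _root_.add_apply]
  abel

theorem lift_single {A X : Type*} [NonUnitalNonAssocRing A] [Module K A] [IsScalarTower K A A]
    [SMulCommClass K A A] (a : X → A) (m : FreeMagma X) (r : K) :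
    FreeNonUnitalNonAssocAlgebra.lift K a (MonoidAlgebra.single m r) = r • FreeMagma.lift a m := by
  simp [FreeNonUnitalNonAssocAlgebra.lift, MonoidAlgebra.liftMagma]

theorem hasNormalForm_single {m : FreeMagma ℕ} (hm : m.length ≤ 4) (r : K) :
    HasNormalForm (MonoidAlgebra.single m r : Poly K) := by
  have hpos := m.length_pos
  obtain h | h | h | h : m.length = 1 ∨ m.length = 2 ∨ m.length = 3 ∨ m.length = 4 := by omega
  · obtain ⟨ε, v, hv⟩ := isLeftNormed_of_length_le_three (K := K) m (n := 0) h (by omega)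
    refine ⟨0, 0, 0, .single v (r * ε), fun A _ _ _ _ hA a => ?_⟩
    simp [lift_single, hv A hA, substForm_single, mul_smul, -Finsupp.single_mul]
  · obtain ⟨ε, v, hv⟩ := isLeftNormed_of_length_le_three (K := K) m (n := 1) h (by omega)
    refine ⟨0, 0, .single v (r * ε), 0, fun A _ _ _ _ hA a => ?_⟩
    simp [lift_single, hv A hA, substForm_single, mul_smul, -Finsupp.single_mul]
  · obtain ⟨ε, v, hv⟩ := isLeftNormed_of_length_le_three (K := K) m (n := 2) h le_rfl
    refine ⟨0, .single v (r * ε), 0, 0, fun A _ _ _ _ hA a => ?_⟩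
    simp [lift_single, hv A hA, substForm_single, mul_smul, -Finsupp.single_mul]
  · obtain ⟨ε, v, hv⟩ | ⟨x, y, rfl, ⟨ε, v, hv⟩, η, w, hw⟩ :=
      isLeftNormed_or_eq_mul_of_length_eq_four (K := K) m h
    · refine ⟨.single v (r * ε, 0), 0, 0, 0, fun A _ _ _ _ hA a => ?_⟩
      simp [lift_single, hv A hA, substForm_single, mul_smul, leftNormed_three_apply]
    · refine ⟨.single ![v 0, v 1, w 0, w 1] (0, r * (ε * η)), 0, 0, 0, fun A _ _ _ _ hA a => ?_⟩
      simp [lift_single, hv A hA, hw A hA, substForm_single, mul_smul, smul_mul_smul_comm,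
        leftNormed_one_apply]

theorem hasNormalForm_of_degree_le {f : Poly K} (hf : degree f ≤ 4) : HasNormalForm f := by
  rw [← f.sum_coeff_single]
  exact Finset.sum_induction _ _ (fun _ _ => HasNormalForm.add) .zero fun m hm =>
    hasNormalForm_single ((Finset.le_sup hm).trans hf) _

end NormalForm

section BilinAlg

variable {K V : Type*} [Field K] [AddCommGroup V] [Module K V]

/-- The vector space `V` with the multiplication given by a bilinear map. -/
def BilinAlg (_ : V →ₗ[K] V →ₗ[K] V) : Type _ := V

variable (μ : V →ₗ[K] V →ₗ[K] V)

instance : AddCommGroup (BilinAlg μ) := inferInstanceAs (AddCommGroup V)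

instance : Module K (BilinAlg μ) := inferInstanceAs (Module K V)

instance : NonUnitalNonAssocRing (BilinAlg μ) :=
  { (inferInstance : AddCommGroup (BilinAlg μ)) with
    mul := fun x y => μ x y
    left_distrib := fun x y z => (μ x).map_add y z
    right_distrib := fun x y z => LinearMap.map_add₂ μ x y z
    zero_mul := fun x => LinearMap.map_zero₂ μ x
    mul_zero := fun x => (μ x).map_zero }

instance : IsScalarTower K (BilinAlg μ) (BilinAlg μ) :=
  ⟨fun r x y => LinearMap.map_smul₂ μ r x y⟩

instance : SMulCommClass K (BilinAlg μ) (BilinAlg μ) :=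
  ⟨fun r x y => ((μ x).map_smul r y).symm⟩

end BilinAlg

section CyclicAlg

variable (K : Type u) [Field K]

/-- The anticommutative multiplication on `K⁴` with `e₀e₁ = e₀`, `e₁e₂ = e₁`, `e₂e₀ = e₂` and
`e₃e₀ = e₃e₁ = e₃e₂ = e₃`. -/
def cyclicMul : (Fin 4 → K) →ₗ[K] (Fin 4 → K) →ₗ[K] (Fin 4 → K) :=
  LinearMap.mk₂ K (fun x y => ![x 0 * y 1 - x 1 * y 0, x 1 * y 2 - x 2 * y 1,
      x 2 * y 0 - x 0 * y 2, x 3 * (y 0 + y 1 + y 2) - (x 0 + x 1 + x 2) * y 3])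
    (fun x x' y => by ext i; fin_cases i <;> simp <;> ring)
    (fun c x y => by ext i; fin_cases i <;> simp <;> ring)
    (fun x y y' => by ext i; fin_cases i <;> simp <;> ring)
    (fun c x y => by ext i; fin_cases i <;> simp <;> ring)

theorem cyclicMul_apply (x y : Fin 4 → K) : cyclicMul K x y =
    ![x 0 * y 1 - x 1 * y 0, x 1 * y 2 - x 2 * y 1, x 2 * y 0 - x 0 * y 2,
      x 3 * (y 0 + y 1 + y 2) - (x 0 + x 1 + x 2) * y 3] := rfl

/-- The form `ω` of the cyclic algebra: minus the sum of the first three coordinates of the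
product. -/
def cyclicForm : LinearMap.BilinForm K (Fin 4 → K) :=
  (cyclicMul K).compr₂ (-∑ i : Fin 3, LinearMap.proj i.castSucc)

theorem cyclicMul_self (x : Fin 4 → K) : cyclicMul K x x = 0 := by
  rw [cyclicMul_apply]
  ext i
  fin_cases i <;> simp <;> ring

theorem cyclicMul_jacobian (x y z : Fin 4 → K) :
    cyclicMul K (cyclicMul K x y) z + cyclicMul K (cyclicMul K z x) y +
      cyclicMul K (cyclicMul K y z) x =
    cyclicForm K x y • z + cyclicForm K z x • y + cyclicForm K y z • x := by
  simp only [cyclicForm, LinearMap.compr₂_apply, cyclicMul_apply, Fin.sum_univ_three]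
  ext i
  fin_cases i <;> simp <;> ring

/-- The `ω`-Lie algebra `K⁴` with the multiplication `cyclicMul`. -/
abbrev CyclicAlg : Type u := BilinAlg (cyclicMul K)

theorem isOmegaLieAlgebra_cyclicAlg : IsOmegaLieAlgebra K (CyclicAlg K) :=
  ⟨cyclicMul_self K, cyclicForm K, cyclicMul_jacobian K⟩

/-- The standard basis of the cyclic algebra. -/
def e (i : Fin 4) : CyclicAlg K := (Pi.single i 1 : Fin 4 → K)

/-- The coordinates with respect to the basis `e`. -/
def coord (i : Fin 4) : CyclicAlg K →ₗ[K] K := (LinearMap.proj i : (Fin 4 → K) →ₗ[K] K)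

variable {K}

theorem CyclicAlg.ext {x y : CyclicAlg K} (h : ∀ i, coord K i x = coord K i y) : x = y :=
  funext h

theorem coord_e (i j : Fin 4) : coord K i (e K j) = if i = j then 1 else 0 :=
  Pi.single_apply j (1 : K) i

theorem coord_mul (i : Fin 4) (x y : CyclicAlg K) : coord K i (x * y) =
    ![coord K 0 x * coord K 1 y - coord K 1 x * coord K 0 y,
      coord K 1 x * coord K 2 y - coord K 2 x * coord K 1 y,
      coord K 2 x * coord K 0 y - coord K 0 x * coord K 2 y,
      coord K 3 x * (coord K 0 y + coord K 1 y + coord K 2 y) -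
        (coord K 0 x + coord K 1 x + coord K 2 x) * coord K 3 y] i := rfl

theorem e_mul_e (i j : Fin 4) : e K i * e K j =
    ![![0, e K 0, -e K 2, -e K 3],
      ![-e K 0, 0, e K 1, -e K 3],
      ![e K 2, -e K 1, 0, -e K 3],
      ![e K 3, e K 3, e K 3, 0]] i j := by
  refine CyclicAlg.ext fun k => ?_
  rw [coord_mul]
  fin_cases i <;> fin_cases j <;> fin_cases k <;> simp [coord_e]

theorem eq_zero_of_three_variable_identity {α β β' γ γ' δ : K}
    (h : ∀ x y z : CyclicAlg K,
      α • (x * y * (x * z)) + β • (x * y * x * z) + β' • (x * z * x * y) +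
        γ • (x * y * z * x) + γ' • (x * z * y * x) + δ • (y * z * x * x) = 0) :
    α = 0 ∧ β = 0 ∧ β' = 0 ∧ γ = 0 ∧ γ' = 0 ∧ δ = 0 := by
  have h₁ := h (e K 0) (e K 1) (e K 2)
  have h₂ := h (e K 0) (e K 2) (e K 1)
  have h₃ := h (e K 0) (e K 3) (e K 1)
  simp only [e_mul_e, Matrix.cons_val, neg_mul, mul_neg, zero_mul, neg_neg, smul_neg, smul_zero,
    add_zero, neg_zero] at h₁ h₂ h₃
  have hγ' : γ' = 0 := by simpa [coord_e] using congrArg (coord K 0) h₁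
  have hβ' : β' = 0 := by simpa [coord_e] using congrArg (coord K 1) h₁
  have hγ : γ = 0 := by simpa [coord_e] using congrArg (coord K 0) h₂
  have hβ : β = 0 := by simpa [coord_e] using congrArg (coord K 1) h₂
  have hα : α = 0 := by simpa [coord_e, hγ'] using congrArg (coord K 2) h₂
  have hδ : δ = 0 := by simpa [coord_e, hα, hβ, hγ, hγ'] using congrArg (coord K 3) h₃
  exact ⟨hα, hβ, hβ', hγ, hγ', hδ⟩

end CyclicAlg

section Collapse

variable {K A : Type*} [Field K] [NonUnitalNonAssocRing A] [Module K A] [IsScalarTower K A A]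
  [SMulCommClass K A A]

theorem multilinearPoly_leftNormedTerm_one_collapse (hA : IsAnticommutative A)
    (p : (Fin 2 → Fin 2) → K) (x : A) :
    multilinearPoly (leftNormedTerm K A 1) p ![x, x] = 0 := by
  rw [multilinearPoly_apply, sum_perm_fin_two fun r _ => leftNormedTerm K A 1 (p r) (![x, x] ∘ r)]
  simp [leftNormed_one_apply, hA x]

theorem multilinearPoly_leftNormedTerm_two_collapse (hA : IsAnticommutative A)
    (p : (Fin 3 → Fin 3) → K) (x y : A) :
    multilinearPoly (leftNormedTerm K A 2) p ![x, x, y] =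
      (p ![0, 2, 1] + p ![1, 2, 0] - p ![2, 0, 1] - p ![2, 1, 0]) • (x * y * x) := by
  rw [multilinearPoly_apply,
    sum_perm_fin_three fun r _ => leftNormedTerm K A 2 (p r) (![x, x, y] ∘ r)]
  simp only [leftNormedTerm_apply, leftNormed_two_apply, Function.comp_apply, Matrix.cons_val,
    hA x, hA.mul_eq_neg_mul y x, zero_mul, neg_mul, smul_zero, smul_neg]
  module

end Collapse

theorem exists_multilinearPoly_quarticTerm_collapse {K : Type u} [Field K]
    (p : (Fin 4 → Fin 4) → K × K) :
    ∃ α β β' γ γ' δ : K, ∀ (A : Type u) [NonUnitalNonAssocRing A] [Module K A]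
      [IsScalarTower K A A] [SMulCommClass K A A], IsAnticommutative A → ∀ x y z : A,
        multilinearPoly (quarticTerm K A) p ![x, x, y, z] =
          α • (x * y * (x * z)) + β • (x * y * x * z) + β' • (x * z * x * y) +
            γ • (x * y * z * x) + γ' • (x * z * y * x) + δ • (y * z * x * x) := by
  refine ⟨(p ![0, 2, 1, 3]).2 - (p ![0, 2, 3, 1]).2 - (p ![0, 3, 1, 2]).2 + (p ![0, 3, 2, 1]).2 +
      (p ![1, 2, 0, 3]).2 - (p ![1, 2, 3, 0]).2 - (p ![1, 3, 0, 2]).2 + (p ![1, 3, 2, 0]).2 -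
      (p ![2, 0, 1, 3]).2 + (p ![2, 0, 3, 1]).2 - (p ![2, 1, 0, 3]).2 + (p ![2, 1, 3, 0]).2 +
      (p ![3, 0, 1, 2]).2 - (p ![3, 0, 2, 1]).2 + (p ![3, 1, 0, 2]).2 - (p ![3, 1, 2, 0]).2,
    (p ![0, 2, 1, 3]).1 + (p ![1, 2, 0, 3]).1 - (p ![2, 0, 1, 3]).1 - (p ![2, 1, 0, 3]).1,
    (p ![0, 3, 1, 2]).1 + (p ![1, 3, 0, 2]).1 - (p ![3, 0, 1, 2]).1 - (p ![3, 1, 0, 2]).1,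
    (p ![0, 2, 3, 1]).1 + (p ![1, 2, 3, 0]).1 - (p ![2, 0, 3, 1]).1 - (p ![2, 1, 3, 0]).1,
    (p ![0, 3, 2, 1]).1 + (p ![1, 3, 2, 0]).1 - (p ![3, 0, 2, 1]).1 - (p ![3, 1, 2, 0]).1,
    (p ![2, 3, 0, 1]).1 + (p ![2, 3, 1, 0]).1 - (p ![3, 2, 0, 1]).1 - (p ![3, 2, 1, 0]).1,
    fun A _ _ _ _ hA x y z => ?_⟩
  rw [multilinearPoly_apply, sum_perm_fin_four fun r _ => quarticTerm K A (p r) (![x, x, y, z] ∘ r)]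
  simp only [quarticTerm_apply, Function.comp_apply, Matrix.cons_val, hA x,
    hA.mul_eq_neg_mul y x, hA.mul_eq_neg_mul z x, hA.mul_eq_neg_mul z y,
    hA.mul_eq_neg_mul (x * z) (x * y), zero_mul, mul_zero, neg_mul, mul_neg, neg_neg, neg_zero,
    smul_zero, smul_neg]
  module

section AlternatingWords

variable {K : Type u} [Field K]

theorem altSum_balanced {A : Type*} [NonUnitalNonAssocRing A] [Module K A] [IsScalarTower K A A]
    [SMulCommClass K A A] (h2 : (2 : K) ≠ 0) (hA : IsAnticommutative A) (y : Fin 4 → A) :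
    altSum (fun ρ : Equiv.Perm (Fin 4) => balanced K A (y ∘ ρ)) = 0 := by
  let τ : Equiv.Perm (Fin 4) := .swap 0 2 * .swap 1 3
  have hτ : Equiv.Perm.sign τ = 1 := by decide
  have hanti (ρ : Equiv.Perm (Fin 4)) :
      balanced K A (y ∘ ⇑(ρ * τ)) = (-1 : K) • balanced K A (y ∘ ρ) := by
    rw [neg_one_smul]
    exact hA.mul_eq_neg_mul _ _
  have hself := altSum_mul_right (fun ρ => balanced K A (y ∘ ρ)) τ
  rw [hτ, Units.val_one, one_smul, funext hanti, altSum_smul, neg_one_smul, neg_eq_iff_add_eq_zero,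
    ← two_smul K] at hself
  exact (smul_eq_zero.1 hself).resolve_left h2

theorem altSum_quarticTerm {A : Type*} [NonUnitalNonAssocRing A] [Module K A]
    [IsScalarTower K A A] [SMulCommClass K A A] (h2 : (2 : K) ≠ 0) (hA : IsAnticommutative A)
    (q : K × K) (y : Fin 4 → A) :
    altSum (fun ρ : Equiv.Perm (Fin 4) => quarticTerm K A q (y ∘ ρ)) =
      q.1 • altSum fun ρ : Equiv.Perm (Fin 4) => leftNormed K A 3 (y ∘ ρ) := by
  calc altSum (fun ρ : Equiv.Perm (Fin 4) => quarticTerm K A q (y ∘ ρ))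
      = altSum fun ρ : Equiv.Perm (Fin 4) =>
          q.1 • leftNormed K A 3 (y ∘ ρ) + q.2 • balanced K A (y ∘ ρ) := rfl
    _ = q.1 • altSum fun ρ : Equiv.Perm (Fin 4) => leftNormed K A 3 (y ∘ ρ) := by
        rw [altSum_add, altSum_smul, altSum_smul, altSum_balanced h2 hA, smul_zero, add_zero]

theorem coord_altSum_leftNormed_one :
    coord K 0 (altSum fun ρ : Equiv.Perm (Fin 2) =>
      leftNormed K (CyclicAlg K) 1 (![e K 0, e K 1] ∘ ρ)) = 2 := by
  rw [altSum,
    sum_perm_fin_two fun r s => s • leftNormed K (CyclicAlg K) 1 (![e K 0, e K 1] ∘ r)]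
  simp [leftNormed_one_apply, e_mul_e, coord_e, one_add_one_eq_two]

theorem coord_altSum_leftNormed_two :
    coord K 0 (altSum fun ρ : Equiv.Perm (Fin 3) =>
      leftNormed K (CyclicAlg K) 2 (![e K 0, e K 1, e K 2] ∘ ρ)) = -2 := by
  rw [altSum,
    sum_perm_fin_three fun r s => s • leftNormed K (CyclicAlg K) 2 (![e K 0, e K 1, e K 2] ∘ r)]
  simp only [leftNormed_two_apply, Function.comp_apply, Matrix.cons_val, e_mul_e, neg_mul, neg_neg,
    smul_neg, neg_smul, one_smul, map_add, map_neg, coord_e, Fin.reduceEq, ↓reduceIte]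
  norm_num

theorem coord_altSum_leftNormed_three :
    coord K 3 (altSum fun ρ : Equiv.Perm (Fin 4) =>
      leftNormed K (CyclicAlg K) 3 (e K ∘ ρ)) = 12 := by
  rw [altSum, sum_perm_fin_four fun r s => s • leftNormed K (CyclicAlg K) 3 (e K ∘ r)]
  simp only [leftNormed_three_apply, Function.comp_apply, Matrix.cons_val, e_mul_e, neg_mul,
    neg_neg, smul_neg, neg_smul, one_smul, map_add, map_neg, coord_e, ↓reduceIte]
  norm_num

end AlternatingWords

section Inheritance

open Nat

variable {K : Type u} [Field K]

theorem cast_factorial_ne_zero (h2 : (2 : K) ≠ 0) (h3 : (3 : K) ≠ 0) {n : ℕ} (hn : n ≤ 4) :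
    (n ! : K) ≠ 0 := by
  have h24 : ((4 ! : ℕ) : K) ≠ 0 := by
    rw [show 4 ! = 2 ^ 3 * 3 from rfl, cast_mul, cast_pow]
    exact mul_ne_zero (pow_ne_zero 3 h2) h3
  obtain ⟨k, hk⟩ := factorial_dvd_factorial hn
  rw [hk, cast_mul] at h24
  exact left_ne_zero_of_mul h24

section

variable {A : Type*} [NonUnitalNonAssocRing A] [Module K A] [IsScalarTower K A A]
  [SMulCommClass K A A]

theorem inheritsMultilinearIdentities_leftNormedTerm_zero :
    InheritsMultilinearIdentities (leftNormedTerm K (CyclicAlg K) 0) (leftNormedTerm K A 0) := by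
  intro p hp
  have hid : p id = 0 := by
    simpa [multilinearPoly_apply, leftNormed_zero_apply, coord_e] using
      congrArg (coord K 0) (congrArg (fun Ψ => Ψ fun _ => e K 0) hp)
  ext y
  simp [multilinearPoly_apply, hid]

theorem inheritsMultilinearIdentities_leftNormedTerm_succ {n : ℕ} (hfact : ((n + 2)! : K) ≠ 0)
    (hcollapse : ∀ p, multilinearPoly (leftNormedTerm K (CyclicAlg K) (n + 1)) p = 0 →
      ∀ y : Fin (n + 2) → A, y 0 = y 1 → multilinearPoly (leftNormedTerm K A (n + 1)) p y = 0)
    (x : Fin (n + 2) → CyclicAlg K)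
    (hx : altSum (fun ρ : Equiv.Perm (Fin (n + 2)) =>
      leftNormed K (CyclicAlg K) (n + 1) (x ∘ ρ)) ≠ 0) :
    InheritsMultilinearIdentities (leftNormedTerm K (CyclicAlg K) (n + 1))
      (leftNormedTerm K A (n + 1)) := by
  refine inheritsMultilinearIdentities_of_collapse hfact hcollapse fun q hq y => ?_
  simp only [leftNormedTerm_apply, altSum_smul] at hq ⊢
  rw [(smul_eq_zero.1 (hq x)).resolve_right hx, zero_smul]

theorem inheritsMultilinearIdentities_leftNormedTerm_one (h2 : (2 : K) ≠ 0)
    (hA : IsAnticommutative A) :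
    InheritsMultilinearIdentities (leftNormedTerm K (CyclicAlg K) 1) (leftNormedTerm K A 1) := by
  refine inheritsMultilinearIdentities_leftNormedTerm_succ (by simpa using h2)
    (fun p _ y hy => ?_) ![e K 0, e K 1] (ne_of_apply_ne (coord K 0) ?_)
  · rw [show y = ![y 1, y 1] from funext (Fin.forall_fin_two.2 ⟨hy, rfl⟩)]
    exact multilinearPoly_leftNormedTerm_one_collapse hA p (y 1)
  · rwa [coord_altSum_leftNormed_one, map_zero]

theorem inheritsMultilinearIdentities_leftNormedTerm_two (h2 : (2 : K) ≠ 0) (h3 : (3 : K) ≠ 0)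
    (hA : IsAnticommutative A) :
    InheritsMultilinearIdentities (leftNormedTerm K (CyclicAlg K) 2) (leftNormedTerm K A 2) := by
  refine inheritsMultilinearIdentities_leftNormedTerm_succ
    (cast_factorial_ne_zero h2 h3 (by norm_num))
    (fun p hp y hy => ?_) ![e K 0, e K 1, e K 2] (ne_of_apply_ne (coord K 0) ?_)
  · have hcyclic := multilinearPoly_leftNormedTerm_two_collapse
      (isOmegaLieAlgebra_cyclicAlg K).anticommutative p (e K 1) (e K 0)
    have hcoeff : p ![0, 2, 1] + p ![1, 2, 0] - p ![2, 0, 1] - p ![2, 1, 0] = 0 := by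
      rw [← neg_eq_zero]
      simpa [hp, e_mul_e, coord_e] using congrArg (coord K 0) hcyclic.symm
    rw [show y = ![y 1, y 1, y 2] by ext i; fin_cases i <;> simp [hy],
      multilinearPoly_leftNormedTerm_two_collapse hA, hcoeff, zero_smul]
  · rwa [coord_altSum_leftNormed_two, map_zero, neg_ne_zero]

end

theorem inheritsMultilinearIdentities_quarticTerm (h2 : (2 : K) ≠ 0) (h3 : (3 : K) ≠ 0)
    {A : Type u} [NonUnitalNonAssocRing A] [Module K A] [IsScalarTower K A A]
    [SMulCommClass K A A] (hA : IsAnticommutative A) :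
    InheritsMultilinearIdentities (quarticTerm K (CyclicAlg K)) (quarticTerm K A) := by
  have hC := (isOmegaLieAlgebra_cyclicAlg K).anticommutative
  refine inheritsMultilinearIdentities_of_collapse (cast_factorial_ne_zero h2 h3 le_rfl)
    (fun p hp y hy => ?_) fun q hq y => ?_
  · obtain ⟨α, β, β', γ, γ', δ, hp'⟩ := exists_multilinearPoly_quarticTerm_collapse p
    obtain ⟨rfl, rfl, rfl, rfl, rfl, rfl⟩ := eq_zero_of_three_variable_identity
      fun x u v : CyclicAlg K => (hp' _ hC x u v).symm.trans (by rw [hp, _root_.zero_apply])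
    rw [show y = ![y 1, y 1, y 2, y 3] by ext i; fin_cases i <;> simp [hy], hp' A hA]
    simp
  · have hne :
        altSum (fun ρ : Equiv.Perm (Fin 4) => leftNormed K (CyclicAlg K) 3 (e K ∘ ρ)) ≠ 0 := by
      refine ne_of_apply_ne (coord K 3) ?_
      rw [coord_altSum_leftNormed_three, map_zero, show (12 : K) = 2 ^ 2 * 3 by norm_num]
      exact mul_ne_zero (pow_ne_zero 2 h2) h3
    have hq₁ : q.1 = 0 := by
      have hq' := hq (e K)
      rw [altSum_quarticTerm h2 hC] at hq'
      exact (smul_eq_zero.1 hq').resolve_right hne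
    rw [altSum_quarticTerm h2 hA, hq₁, zero_smul]

end Inheritance

section MinimalDegree

variable {K : Type u} [Field K]

theorem isTrivialIdentity_of_satisfies_cyclicAlg (h2 : (2 : K) ≠ 0) (h3 : (3 : K) ≠ 0) {f : Poly K}
    (hf : degree f ≤ 4) (hC : Satisfies (CyclicAlg K) f) : IsTrivialIdentity f := by
  obtain ⟨c₄, c₃, c₂, c₁, hnf⟩ := hasNormalForm_of_degree_le hf
  have hfact {n : ℕ} (hn : n ≤ 4) : (n.factorial : K) ≠ 0 := cast_factorial_ne_zero h2 h3 hn
  intro A _ _ _ _ hA a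
  have inherits₄ := inheritsMultilinearIdentities_quarticTerm h2 h3 hA
  have inherits₃ := inheritsMultilinearIdentities_leftNormedTerm_two h2 h3 hA
  have inherits₂ := inheritsMultilinearIdentities_leftNormedTerm_one h2 hA
  have inherits₁ := inheritsMultilinearIdentities_leftNormedTerm_zero (K := K) (A := A)
  have h₄ (a : ℕ → CyclicAlg K) :=
    (hnf _ (isOmegaLieAlgebra_cyclicAlg K).anticommutative a).symm.trans (hC a)
  obtain ⟨hA₄, h₃⟩ := inherits₄.eq_zero_of_add_eq_zero (hfact le_rfl)
    ((hasDegreeLT_diag (by norm_num) _).add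
      ((hasDegreeLT_diag (by norm_num) _).add (hasDegreeLT_diag (by norm_num) _))) h₄
  obtain ⟨hA₃, h₂⟩ := inherits₃.eq_zero_of_add_eq_zero (hfact (by norm_num))
    ((hasDegreeLT_diag (by norm_num) _).add (hasDegreeLT_diag (by norm_num) _)) h₃
  obtain ⟨hA₂, h₁⟩ := inherits₂.eq_zero_of_add_eq_zero (hfact (by norm_num))
    (hasDegreeLT_diag (by norm_num) _) h₂
  obtain ⟨hA₁, -⟩ := inherits₁.eq_zero_of_add_eq_zero (hfact (by norm_num)) (hasDegreeLT_zero 1)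
    fun a => (add_zero _).trans (h₁ a)
  rw [hnf A hA, hA₄, hA₃, hA₂, hA₁]
  simp only [add_zero]

end MinimalDegree

section Transfer

variable {K : Type u} [Field K]

theorem IsOmegaLieAlgebra.of_injective {L M : Type*} [NonUnitalNonAssocRing L] [Module K L]
    [NonUnitalNonAssocRing M] [Module K M] (hM : IsOmegaLieAlgebra K M) (φ : L →ₙₐ[K] M)
    (hφ : Function.Injective φ) : IsOmegaLieAlgebra K L := by
  obtain ⟨ω, hω⟩ := hM.exists_form
  refine ⟨fun x => hφ ?_, ω.compl₁₂ (φ : L →ₗ[K] M) (φ : L →ₗ[K] M), fun x y z => hφ ?_⟩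
  · rw [map_mul, hM.anticommutative, map_zero]
  · simpa [jacobian] using hω (φ x) (φ y) (φ z)

theorem Satisfies.of_surjective {L M : Type*} [NonUnitalNonAssocRing L] [Module K L]
    [IsScalarTower K L L] [SMulCommClass K L L] [NonUnitalNonAssocRing M] [Module K M]
    [IsScalarTower K M M] [SMulCommClass K M M] {f : Poly K} (hf : Satisfies L f)
    (φ : L →ₙₐ[K] M) (hφ : Function.Surjective φ) : Satisfies M f := by
  intro a
  choose b hb using fun i => hφ (a i)
  have hcomp : φ.comp (FreeNonUnitalNonAssocAlgebra.lift K b) =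
      FreeNonUnitalNonAssocAlgebra.lift K a :=
    FreeNonUnitalNonAssocAlgebra.hom_ext K fun i => by simp [hb]
  rw [← hcomp, NonUnitalAlgHom.comp_apply, hf b, map_zero]

theorem HoldsInOmegaLieAlgebras.satisfies {f : Poly K}
    (hf : HoldsInOmegaLieAlgebras.{u, v} f) {L : Type u} [NonUnitalNonAssocRing L] [Module K L]
    [IsScalarTower K L L] [SMulCommClass K L L] (hL : IsOmegaLieAlgebra K L) :
    Satisfies L f := by
  have : IsScalarTower K (ULift.{v} L) (ULift.{v} L) :=
    ⟨fun r x y => ULift.ext _ _ (smul_mul_assoc r x.down y.down)⟩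
  have : SMulCommClass K (ULift.{v} L) (ULift.{v} L) :=
    ⟨fun r x y => ULift.ext _ _ (mul_smul_comm r x.down y.down).symm⟩
  let down : ULift.{v} L →ₙₐ[K] L :=
    { toFun := ULift.down
      map_smul' := fun _ _ => rfl
      map_zero' := rfl
      map_add' := fun _ _ => rfl
      map_mul' := fun _ _ => rfl }
  exact (hf _ (hL.of_injective down ULift.down_injective)).of_surjective down ULift.down_surjective

end Transfer

section Quintic

/-- The expression `[[[[x₀, x₁], x₂], x₃], x₄] + [[[x₀, x₁], x₂], [x₃, x₄]]`, whose alternating sum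
is the quintic identity. -/
def quinticWord {A : Type*} [NonUnitalNonAssocRing A] (x : Fin 5 → A) : A :=
  x 0 * x 1 * x 2 * x 3 * x 4 + x 0 * x 1 * x 2 * (x 3 * x 4)

variable {K : Type u} [Field K]

theorem lift_quinticPoly {A : Type*} [NonUnitalNonAssocRing A] [Module K A]
    [IsScalarTower K A A] [SMulCommClass K A A] (a : ℕ → A) :
    FreeNonUnitalNonAssocAlgebra.lift K a (quinticPoly K) =
      altSum fun σ : Equiv.Perm (Fin 5) => quinticWord fun i => a (σ i) := by
  simp only [quinticPoly, altSum, quinticWord, map_sum, map_zsmul, map_add, map_mul,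
    FreeNonUnitalNonAssocAlgebra.lift_of_apply]

theorem quinticWord_cyclic {L : Type*} [NonUnitalNonAssocRing L] [Module K L]
    [IsScalarTower K L L] (hL : IsAnticommutative L) {ω : LinearMap.BilinForm K L}
    (hω : ∀ x y z : L, jacobian x y z = ω x y • z + ω z x • y + ω y z • x) (x : Fin 5 → L) :
    quinticWord x + quinticWord ![x 1, x 2, x 0, x 3, x 4] +
        quinticWord ![x 2, x 0, x 1, x 3, x 4] =
      (ω (x 0) (x 1) • (x 2 * x 3 * x 4) - ω (x 0) (x 1) • (x 3 * x 4 * x 2)) +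
        (ω (x 1) (x 2) • (x 0 * x 3 * x 4) - ω (x 1) (x 2) • (x 3 * x 4 * x 0)) +
        (ω (x 2) (x 0) • (x 1 * x 3 * x 4) - ω (x 2) (x 0) • (x 3 * x 4 * x 1)) := by
  calc quinticWord x + quinticWord ![x 1, x 2, x 0, x 3, x 4] +
        quinticWord ![x 2, x 0, x 1, x 3, x 4]
      = jacobian (x 0) (x 1) (x 2) * x 3 * x 4 + jacobian (x 0) (x 1) (x 2) * (x 3 * x 4) := by
        simp only [quinticWord, jacobian, add_mul, Matrix.cons_val]
        abel
    _ = _ := by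
        simp only [hω, hL.mul_eq_neg_mul (x 3 * x 4), add_mul, smul_mul_assoc, smul_neg]
        abel

theorem altSum_quinticWord (h3 : (3 : K) ≠ 0) {L : Type*} [NonUnitalNonAssocRing L] [Module K L]
    [IsScalarTower K L L] (hL : IsOmegaLieAlgebra K L) (x : Fin 5 → L) :
    altSum (fun σ : Equiv.Perm (Fin 5) => quinticWord (x ∘ σ)) = 0 := by
  obtain ⟨ω, hω⟩ := hL.exists_form
  let κ : Equiv.Perm (Fin 5) := .swap 0 1 * .swap 1 2
  let τ : Equiv.Perm (Fin 5) := .swap 2 3 * .swap 3 4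
  have hκ : Equiv.Perm.sign κ = 1 := by decide
  have hτ : Equiv.Perm.sign τ = 1 := by decide
  let u (σ : Equiv.Perm (Fin 5)) : L := ω (x (σ 0)) (x (σ 1)) • (x (σ 2) * x (σ 3) * x (σ 4))
  have hcyclic (σ : Equiv.Perm (Fin 5)) :
      quinticWord (x ∘ σ) + quinticWord (x ∘ ⇑(σ * κ)) + quinticWord (x ∘ ⇑(σ * κ * κ)) =
        (u σ - u (σ * τ)) + (u (σ * κ) - u (σ * κ * τ)) +
          (u (σ * κ * κ) - u (σ * κ * κ * τ)) := by
    let y := x ∘ σ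
    have hκσ : x ∘ ⇑(σ * κ) = ![y 1, y 2, y 0, y 3, y 4] := by ext i; fin_cases i <;> rfl
    have hκκσ : x ∘ ⇑(σ * κ * κ) = ![y 2, y 0, y 1, y 3, y 4] := by ext i; fin_cases i <;> rfl
    rw [hκσ, hκκσ]
    exact quinticWord_cyclic hL.anticommutative hω y
  have hcancel : altSum (fun σ => u σ - u (σ * τ)) = 0 := by
    rw [altSum_sub, altSum_mul_right, hτ, Units.val_one, one_smul, sub_self]
  have htriple : 3 • altSum (fun σ : Equiv.Perm (Fin 5) => quinticWord (x ∘ σ)) = 0 := by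
    rw [← altSum_cyclic _ hκ, funext hcyclic, altSum_cyclic (fun σ => u σ - u (σ * τ)) hκ, hcancel,
      smul_zero]
  rw [← Nat.cast_smul_eq_nsmul K] at htriple
  exact (smul_eq_zero.1 htriple).resolve_left (by exact_mod_cast h3)

theorem holdsInOmegaLieAlgebras_quinticPoly (h3 : (3 : K) ≠ 0) :
    HoldsInOmegaLieAlgebras.{u, v} (quinticPoly K) := fun L _ _ _ _ hL a => by
  rw [lift_quinticPoly]
  exact altSum_quinticWord h3 hL fun i => a i

end Quintic

section ChainAlgebra

variable {K : Type u} [Field K]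

variable (K) in
/-- The multiplication of the nine-dimensional nilpotent anticommutative algebra with
`e₀e₁ = e₅`, `e₅e₂ = e₆`, `e₆e₃ = e₇`, `e₇e₄ = e₈`, in which the alternating sum of
`[[[[x₀, x₁], x₂], x₃], x₄]` does not vanish. -/
def chainMul : (Fin 9 → K) →ₗ[K] (Fin 9 → K) →ₗ[K] (Fin 9 → K) :=
  LinearMap.mk₂ K (fun x y => ![0, 0, 0, 0, 0, x 0 * y 1 - x 1 * y 0, x 5 * y 2 - x 2 * y 5,
      x 6 * y 3 - x 3 * y 6, x 7 * y 4 - x 4 * y 7])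
    (fun x x' y => by ext i; fin_cases i <;> simp <;> ring)
    (fun c x y => by ext i; fin_cases i <;> simp <;> ring)
    (fun x y y' => by ext i; fin_cases i <;> simp <;> ring)
    (fun c x y => by ext i; fin_cases i <;> simp <;> ring)

theorem chainMul_apply (x y : Fin 9 → K) : chainMul K x y =
    ![0, 0, 0, 0, 0, x 0 * y 1 - x 1 * y 0, x 5 * y 2 - x 2 * y 5,
      x 6 * y 3 - x 3 * y 6, x 7 * y 4 - x 4 * y 7] := rfl

theorem chainMul_self (x : Fin 9 → K) : chainMul K x x = 0 := by
  rw [chainMul_apply]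
  ext i
  fin_cases i <;> simp <;> ring

theorem quinticWord_chainMul (x : Fin 5 → Fin 9 → K)
    (hx : ∀ i, x i 5 = 0 ∧ x i 6 = 0 ∧ x i 7 = 0) :
    (quinticWord (A := BilinAlg (chainMul K)) x : Fin 9 → K) 8 =
      (x 0 0 * x 1 1 - x 0 1 * x 1 0) * x 2 2 * x 3 3 * x 4 4 := by
  change (chainMul K (chainMul K (chainMul K (chainMul K (x 0) (x 1)) (x 2)) (x 3)) (x 4) +
    chainMul K (chainMul K (chainMul K (x 0) (x 1)) (x 2)) (chainMul K (x 3) (x 4))) 8 = _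
  simp [chainMul_apply, hx]

theorem altSum_minor_mul_eq_two_mul_det {R : Type*} [CommRing R] (A : Matrix (Fin 5) (Fin 5) R) :
    altSum (fun σ : Equiv.Perm (Fin 5) =>
      (A (σ 0) 0 * A (σ 1) 1 - A (σ 0) 1 * A (σ 1) 0) * A (σ 2) 2 * A (σ 3) 3 * A (σ 4) 4) =
      2 * A.det := by
  let d (σ : Equiv.Perm (Fin 5)) : R := ∏ j, A (σ j) j
  have hdet : altSum d = A.det := A.det_apply.symm
  calc _ = altSum fun σ => d σ - d (σ * .swap 0 1) := by
        congr 1 with σ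
        have hswap (j : Fin 5) : (σ * .swap 0 1) j = σ (![1, 0, 2, 3, 4] j) := by
          fin_cases j <;> rfl
        simp only [d, hswap, Fin.prod_univ_five, Matrix.cons_val]
        ring
    _ = 2 * A.det := by
        rw [altSum_sub, altSum_mul_right, hdet, Equiv.Perm.sign_swap zero_ne_one, Units.val_neg,
          Units.val_one, neg_one_smul, sub_neg_eq_add, two_mul]

variable (K) in
theorem not_isTrivialIdentity_quinticPoly (h2 : (2 : K) ≠ 0) :
    ¬ IsTrivialIdentity (quinticPoly K) := by
  intro h
  let b (i : ℕ) : Fin 9 → K := fun k => if i = k then 1 else 0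
  have hb (i : Fin 5) : b i 5 = 0 ∧ b i 6 = 0 ∧ b i 7 = 0 := by fin_cases i <;> simp [b]
  let B : Matrix (Fin 5) (Fin 5) K := .of fun i k => b i (k.castLE (by norm_num))
  have hB : B = 1 := by
    ext i k
    simp [B, b, Matrix.one_apply, Fin.ext_iff]
  have hzero : altSum (fun σ : Equiv.Perm (Fin 5) =>
      quinticWord (A := BilinAlg (chainMul K)) fun i => b (σ i)) = 0 :=
    (lift_quinticPoly (A := BilinAlg (chainMul K)) b).symm.trans
      (h (BilinAlg (chainMul K)) chainMul_self b)
  have hdet : 2 * B.det = 0 := by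
    let π : BilinAlg (chainMul K) →ₗ[K] K := (LinearMap.proj 8 : (Fin 9 → K) →ₗ[K] K)
    rw [← altSum_minor_mul_eq_two_mul_det, ← π.map_zero, ← hzero, altSum, altSum, map_sum]
    refine Finset.sum_congr rfl fun σ _ => ?_
    rw [map_zsmul]
    exact congrArg _ (quinticWord_chainMul (fun i => b (σ i)) fun i => hb (σ i)).symm
  exact h2 (by simpa [hB] using hdet)

theorem degree_le_iff {f : Poly K} {n : ℕ} :
    degree f ≤ n ↔ f.coeff ∈ Finsupp.supported K K {m : FreeMagma ℕ | m.length ≤ n} := by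
  rw [degree, Finset.sup_le_iff, Finsupp.mem_supported]
  rfl

theorem degree_quinticPoly_le : degree (quinticPoly K) ≤ 5 := by
  have hword (m : FreeMagma ℕ) (hm : m.length ≤ 5) :
      (MonoidAlgebra.single m (1 : K)).coeff ∈
        Finsupp.supported K K {m : FreeMagma ℕ | m.length ≤ 5} := by
    rw [MonoidAlgebra.coeff_single]
    exact Finsupp.single_mem_supported K 1 hm
  have hvar (i : ℕ) : var K i = MonoidAlgebra.single (FreeMagma.of i) 1 := rfl
  rw [degree_le_iff]
  simp only [quinticPoly, hvar, MonoidAlgebra.single_mul_single, mul_one, MonoidAlgebra.coeff_sum,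
    MonoidAlgebra.coeff_smul, MonoidAlgebra.coeff_add]
  exact sum_mem fun σ _ => zsmul_mem (add_mem (hword _ le_rfl) (hword _ le_rfl)) _

theorem degree_quinticPoly (h2 : (2 : K) ≠ 0) (h3 : (3 : K) ≠ 0) : degree (quinticPoly K) = 5 := by
  refine degree_quinticPoly_le.antisymm (not_lt.1 fun hlt => ?_)
  exact not_isTrivialIdentity_quinticPoly K h2 <| isTrivialIdentity_of_satisfies_cyclicAlg h2 h3
    (Nat.le_of_lt_succ hlt) <|
      (holdsInOmegaLieAlgebras_quinticPoly.{u, u} h3).satisfies (isOmegaLieAlgebra_cyclicAlg K)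

end ChainAlgebra

section Counterexamples

variable {K : Type u} [Field K]

theorem not_holdsInOmegaLieAlgebras_engelPoly :
    ¬ HoldsInOmegaLieAlgebras.{u, v} (engelPoly K) := by
  intro h
  have h₀ := h.satisfies (isOmegaLieAlgebra_cyclicAlg K) fun | 0 => e K 0 | _ => e K 3
  simp only [engelPoly, map_mul, FreeNonUnitalNonAssocAlgebra.lift_of_apply, e_mul_e,
    Matrix.cons_val] at h₀
  simpa [coord_e] using congrArg (coord K 3) h₀

theorem not_holdsInOmegaLieAlgebras_threeParamPoly {α β γ : K}
    (hne : ¬ (α = 0 ∧ β = 0 ∧ γ = 0)) :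
    ¬ HoldsInOmegaLieAlgebras.{u, v} (threeParamPoly K α β γ) := by
  intro h
  obtain ⟨hα, hβ, -, hγ, -, -⟩ := eq_zero_of_three_variable_identity (K := K) (α := α) (β := β)
    (β' := -β) (γ := γ) (γ' := -γ) (δ := β + γ) fun x y z => by
      have h₀ := h.satisfies (isOmegaLieAlgebra_cyclicAlg K) fun | 0 => x | 1 => y | _ => z
      simp only [threeParamPoly, map_mul, map_add, map_sub, map_smul,
        FreeNonUnitalNonAssocAlgebra.lift_of_apply] at h₀
      rw [← h₀]
      module
  exact hne ⟨hα, hβ, hγ⟩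

theorem not_holdsInOmegaLieAlgebras_binaryLiePoly :
    ¬ HoldsInOmegaLieAlgebras.{u, v} (binaryLiePoly K) := by
  intro h
  have h₀ := h.satisfies (isOmegaLieAlgebra_cyclicAlg K) fun | 0 => e K 0 | _ => e K 1 + e K 3
  simp only [binaryLiePoly, jacobian, map_mul, map_add,
    FreeNonUnitalNonAssocAlgebra.lift_of_apply] at h₀
  simpa [coord_e, add_mul, mul_add, e_mul_e] using congrArg (coord K 3) h₀

theorem not_holdsInOmegaLieAlgebras_alternatingJacobianPoly (h2 : (2 : K) ≠ 0)
    (h3 : (3 : K) ≠ 0) : ¬ HoldsInOmegaLieAlgebras.{u, v} (alternatingJacobianPoly K) := by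
  intro h
  have h₀ := h.satisfies (isOmegaLieAlgebra_cyclicAlg K)
    fun | 0 => e K 0 | 1 => e K 1 | 2 => e K 2 | _ => e K 3
  simp only [alternatingJacobianPoly, jacobian, map_mul, map_add, map_sub,
    FreeNonUnitalNonAssocAlgebra.lift_of_apply] at h₀
  have h₆ : (6 : K) = 0 := by
    refine Eq.trans ?_ (congrArg (coord K 3) h₀)
    simp only [e_mul_e, Matrix.cons_val, add_mul, neg_mul, neg_neg, map_add, map_sub, map_neg,
      coord_e, ↓reduceIte]
    norm_num
  exact mul_ne_zero h2 h3 (by linear_combination h₆)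

end Counterexamples

theorem natCast_ne_zero_of_ringChar_ne {R : Type*} [Ring R] [Nontrivial R] {p : ℕ} (hp : p.Prime)
    (h : ringChar R ≠ p) : (p : R) ≠ 0 := fun h0 =>
  ((Nat.dvd_prime hp).1 (ringChar.dvd h0)).elim CharP.ringChar_ne_one h

end OmegaLie

theorem proposition10p1 (K : Type u) [Field K] (h2 : ringChar K ≠ 2) (h3 : ringChar K ≠ 3) :
    -- the minimal degree of a nontrivial identity of all `ω`-Lie algebras is `5`
    IsLeast {n : ℕ | ∃ f : OmegaLie.Poly K, ¬ OmegaLie.IsTrivialIdentity f ∧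
        OmegaLie.degree f = n ∧ OmegaLie.HoldsInOmegaLieAlgebras.{u, v} f} 5 ∧
    -- the explicit identity of degree `5`
    (¬ OmegaLie.IsTrivialIdentity (OmegaLie.quinticPoly K) ∧
      OmegaLie.degree (OmegaLie.quinticPoly K) = 5 ∧
      OmegaLie.HoldsInOmegaLieAlgebras.{u, v} (OmegaLie.quinticPoly K)) ∧
    -- each of the irreducible identities of degree at most `4` fails in some `ω`-Lie algebra
    ¬ OmegaLie.HoldsInOmegaLieAlgebras.{u, v} (OmegaLie.engelPoly K) ∧
    (∀ α β γ : K, ¬ (α = 0 ∧ β = 0 ∧ γ = 0) →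
      ¬ OmegaLie.HoldsInOmegaLieAlgebras.{u, v} (OmegaLie.threeParamPoly K α β γ)) ∧
    ¬ OmegaLie.HoldsInOmegaLieAlgebras.{u, v} (OmegaLie.binaryLiePoly K) ∧
    ¬ OmegaLie.HoldsInOmegaLieAlgebras.{u, v} (OmegaLie.alternatingJacobianPoly K) := by
  have two_ne : (2 : K) ≠ 0 := OmegaLie.natCast_ne_zero_of_ringChar_ne Nat.prime_two h2
  have three_ne : (3 : K) ≠ 0 := OmegaLie.natCast_ne_zero_of_ringChar_ne Nat.prime_three h3
  have quintic := And.intro (OmegaLie.not_isTrivialIdentity_quinticPoly K two_ne)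
    (And.intro (OmegaLie.degree_quinticPoly two_ne three_ne)
      (OmegaLie.holdsInOmegaLieAlgebras_quinticPoly.{u, v} three_ne))
  refine ⟨⟨⟨_, quintic⟩, ?_⟩, quintic, OmegaLie.not_holdsInOmegaLieAlgebras_engelPoly,
    fun _ _ _ => OmegaLie.not_holdsInOmegaLieAlgebras_threeParamPoly,
    OmegaLie.not_holdsInOmegaLieAlgebras_binaryLiePoly,
    OmegaLie.not_holdsInOmegaLieAlgebras_alternatingJacobianPoly two_ne three_ne⟩
  rintro n ⟨f, hf, rfl, hholds⟩
  by_contra! hlt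
  exact hf (OmegaLie.isTrivialIdentity_of_satisfies_cyclicAlg two_ne three_ne
    (Nat.le_of_lt_succ hlt) (hholds.satisfies (OmegaLie.isOmegaLieAlgebra_cyclicAlg K)))
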